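/- Let $\mathcal{H}$ be a complex separable Hilbert space, $\mathcal{B}(\mathcal{H})$ the algebra of bounded linear operators on $\mathcal{H}$, and $\mathcal{K}(\mathcal{H})$ the ideal of compact operators. Let $T_1, T_2 \in \mathcal{B}(\mathcal{H})$ be idempotents ($T_i^2 = T_i$, not necessarily self-adjoint) that are essentially commuting, that is, $T_1T_2 - T_2T_1 \in \mathcal{K}(\mathcal{H})$. Then at least one of the following holds: 1. $T_1 + T_2 - I \in \mathcal{K}(\mathcal{H})$; 2. $T_1 - T_2 \in \mathcal{K}(\mathcal{H})$; 3. there exists an idempotent $S \in \mathcal{B}(\mathcal{H})$, with range $\mathcal{R}(S)$ and null space $\mathcal{N}(S^*)$ both infinite-dimensional, such that $(T_1 - T_2)^2 - S \in \mathcal{K}(\mathcal{H})$ and $(T_1 + T_2 - I)S \in \mathcal{K}(\mathcal{H})$. -/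

import Mathlib

/-!
Modulo the compact operators the two idempotents become commuting idempotents `t₁`, `t₂`.  For
these, `s = (t₁ - t₂) ^ 2` is again idempotent, `(t₁ + t₂ - 1) * s = 0`, and
`(t₁ - t₂) * s = t₁ - t₂`.  The substance of the theorem is that `s` lifts to a genuine idempotent
operator `S`.  Then `(T₁ - T₂) ^ 2 - S` and `(T₁ + T₂ - 1) * S` are compact; if `S` has finite rank
then `s = 0`, so `t₁ = t₂`, and if `ker S†` is finite-dimensional then `1 - S†`, whose range is
`ker S†`, is compact, so `s = 1` and `t₁ + t₂ = 1`.

The lifting goes as follows.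

* For a self-adjoint lift `M` of an idempotent, `M ^ 2 - M` is compact and self-adjoint, so it has
  only countably many eigenvalues, and by the Fredholm alternative some `c ∈ (0, 1)` is not in the
  spectrum of `M`.  The spectral projection `P` of `M` for `(c, ∞)` is given by the continuous
  functional calculus, and `P - M` is a multiple of `M ^ 2 - M`
  (`exists_isIdempotentElem_of_isSelfAdjoint`).
* If `A` lifts an arbitrary idempotent `s`, let `t` be the class of `A†`.  The element
  `p = s t (1 + (s - t)(t - s))⁻¹` is the range projection of `s`: it is idempotent, `s p = p` and
  `p s = s`.  It has a self-adjoint lift, hence an idempotent lift `P`, and then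
  `S = P + P A (1 - P)` is an idempotent lift of `p + p s (1 - p) = s`
  (`exists_isIdempotentElem_isCompactOperator_sub`).
-/

open ContinuousLinearMap Module.End

/-! ### Idempotents in rings -/

section Algebra

/-- The inverse of `1 + (s - t) * (t - s)` commutes with `s * t`, and produces from `s * t` an
idempotent with the same right ideal as `s`. -/
theorem range_idempotent_relations {R : Type*} [Ring R] {s t e : R} (hs : s * s = s)
    (ht : t * t = t) (hl : e * (1 + (s - t) * (t - s)) = 1)
    (hr : (1 + (s - t) * (t - s)) * e = 1) :
    e * (s * t) = s * t * e ∧ s * t * e * s = s ∧ s * t * e * (s * t * e) = s * t * e := by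
  set d := 1 + (s - t) * (t - s) with hd
  have hsts (x : R) : s * (s * x) = s * x := by rw [← mul_assoc, hs]
  have htt (x : R) : t * (t * x) = t * x := by rw [← mul_assoc, ht]
  have hds : d * s = s * t * s := by
    simp only [hd, mul_sub, sub_mul, add_mul, mul_assoc, hs, ht, one_mul]; abel
  have hsd : s * d = s * t * s := by
    simp only [hd, mul_sub, sub_mul, mul_add, mul_assoc, hs, ht, hsts, mul_one]; abel
  have hdt : d * t = t * s * t := by
    simp only [hd, mul_sub, sub_mul, add_mul, mul_assoc, hs, ht, one_mul]; abel
  have htd : t * d = t * s * t := by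
    simp only [hd, mul_sub, sub_mul, mul_add, mul_assoc, hs, ht, htt, mul_one]; abel
  -- What commutes with `d` commutes with its inverse.
  have hcomm {x : R} (hx : d * x = x * d) : e * x = x * e := by
    calc e * x = e * (x * d) * e := by rw [mul_assoc, mul_assoc x, hr, mul_one]
      _ = x * e := by rw [← hx, ← mul_assoc, hl, one_mul]
  have hes := hcomm (hds.trans hsd.symm)
  have het := hcomm (hdt.trans htd.symm)
  have hps : s * t * e * s = s := by
    rw [mul_assoc, hes, ← mul_assoc, ← hsd, mul_assoc, hr, mul_one]
  refine ⟨?_, hps, ?_⟩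
  · rw [← mul_assoc, hes, mul_assoc, het, mul_assoc]
  · rw [← mul_assoc, ← mul_assoc, hps]

theorem isIdempotentElem_add_mul_one_sub {R : Type*} [Ring R] {p : R} (hp : IsIdempotentElem p)
    (a : R) : IsIdempotentElem (p + p * a * (1 - p)) := by
  have h : (1 - p) * p = 0 := by rw [sub_mul, one_mul, hp.eq, sub_self]
  calc (p + p * a * (1 - p)) * (p + p * a * (1 - p))
      = p * p + p * p * a * (1 - p) + p * a * ((1 - p) * p)
        + p * a * ((1 - p) * p) * a * (1 - p) := by noncomm_ring
    _ = p + p * a * (1 - p) := by rw [h, hp.eq]; simp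

/-- The square of the difference of two commuting idempotents is their symmetric difference. -/
theorem sub_sq_relations {R : Type*} [Ring R] {a b : R} (ha : a * a = a) (hb : b * b = b)
    (h : a * b = b * a) :
    (a - b) ^ 2 * (a - b) ^ 2 = (a - b) ^ 2 ∧ (a + b - 1) * (a - b) ^ 2 = 0 ∧
      (a - b) * (a - b) ^ 2 = a - b := by
  have ha' (x : R) : a * (a * x) = a * x := by rw [← mul_assoc, ha]
  have hba' (x : R) : b * (a * x) = a * (b * x) := by rw [← mul_assoc, ← h, mul_assoc]
  refine ⟨?_, ?_, ?_⟩ <;>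
  · simp only [pow_two, mul_sub, sub_mul, add_mul, mul_assoc, one_mul, ha, hb, ha', hba', ← h]
    abel

end Algebra

/-! ### The ideal of compact operators -/

section Compact

variable {H : Type*} [NormedAddCommGroup H] [InnerProductSpace ℂ H]

/-- The ideal of compact operators. It is encoded as a left ideal, with the `IsTwoSided` instance
below making the quotient by it, the Calkin algebra, a ring. -/
def compactIdeal (H : Type*) [NormedAddCommGroup H] [InnerProductSpace ℂ H] :
    Ideal (H →L[ℂ] H) where
  carrier := {T | IsCompactOperator T}
  zero_mem' := isCompactOperator_zero
  add_mem' hS hT := IsCompactOperator.add hS hT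
  smul_mem' S _ hT := IsCompactOperator.clm_comp hT S

instance : (compactIdeal H).IsTwoSided where
  mul_mem_of_left S hT := IsCompactOperator.comp_clm hT S

theorem mk_eq_mk_iff_isCompactOperator_sub {S T : H →L[ℂ] H} :
    Ideal.Quotient.mk (compactIdeal H) S = Ideal.Quotient.mk (compactIdeal H) T ↔
      IsCompactOperator (S - T : H →L[ℂ] H) :=
  Ideal.Quotient.eq

theorem isCompactOperator_of_finiteDimensional_range {T : H →L[ℂ] H}
    (hT : FiniteDimensional ℂ (LinearMap.range (T : H →ₗ[ℂ] H))) : IsCompactOperator T := by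
  have : ProperSpace (LinearMap.range (T : H →ₗ[ℂ] H)) := FiniteDimensional.proper ℂ _
  let T' : H →L[ℂ] LinearMap.range (T : H →ₗ[ℂ] H) :=
    T.codRestrict _ fun x => LinearMap.mem_range_self (T : H →ₗ[ℂ] H) x
  have hT' : IsCompactOperator T' := isCompactOperator_of_locallyCompactSpace_dom T'
  exact hT'.clm_comp (Submodule.subtypeL _)

variable [CompleteSpace H]

/-- Schauder's theorem on a Hilbert space: since `‖T† z‖ ^ 2 ≤ ‖T (T† z)‖ * ‖z‖`, a finite net for
the image of the ball under `T * T†` yields one for its image under `T†`. -/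
theorem isCompactOperator_adjoint {T : H →L[ℂ] H} (hT : IsCompactOperator T) :
    IsCompactOperator (adjoint T) := by
  have hTT : IsCompactOperator (T * adjoint T : H →L[ℂ] H) := hT.comp_clm (adjoint T)
  have hest (z : H) : ‖adjoint T z‖ ^ 2 ≤ ‖(T * adjoint T : H →L[ℂ] H) z‖ * ‖z‖ := by
    have h := norm_inner_le_norm (𝕜 := ℂ) ((T * adjoint T : H →L[ℂ] H) z) z
    rwa [mul_apply_eq_comp, ← adjoint_inner_right, inner_self_eq_norm_sq_to_K, norm_pow,
      RCLike.norm_ofReal, abs_norm] at h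
  have htb := ((isCompactOperator_iff_isCompact_closure_image_ball
    (T * adjoint T : H →L[ℂ] H).toLinearMap one_pos).1 hTT).totallyBounded.subset subset_closure
  refine (isCompactOperator_iff_isCompact_closure_image_ball
    (adjoint T).toLinearMap one_pos).2 (TotallyBounded.isCompact_of_isClosed ?_ isClosed_closure)
  refine TotallyBounded.closure (Metric.totallyBounded_iff.2 fun ε hε => ?_)
  obtain ⟨u, hu, hfin, hcov⟩ := totallyBounded_iff_subset.1 htb _
    (Metric.dist_mem_uniformity (show 0 < ε ^ 2 / 2 by positivity))
  obtain ⟨v, hv, hvfin, rfl⟩ := Set.exists_subset_image_finite_and.1 ⟨u, hu, hfin, rfl⟩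
  refine ⟨_, hvfin.image (adjoint T), ?_⟩
  rintro _ ⟨x, hx, rfl⟩
  obtain ⟨_, ⟨y, hy, rfl⟩, hxy⟩ := Set.mem_iUnion₂.1 (hcov ⟨x, hx, rfl⟩)
  refine Set.mem_iUnion₂.2 ⟨_, ⟨y, hy, rfl⟩, ?_⟩
  have hx1 : ‖x‖ < 1 := by simpa using hx
  have hy1 : ‖y‖ < 1 := by simpa using hv hy
  have hxy' : ‖(T * adjoint T : H →L[ℂ] H) (x - y)‖ < ε ^ 2 / 2 := by
    rw [map_sub, ← dist_eq_norm]; exact hxy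
  have hz : ‖x - y‖ ≤ 2 := (norm_sub_le x y).trans (by linarith)
  have := hest (x - y)
  rw [Metric.mem_ball, dist_eq_norm]
  change ‖adjoint T x - adjoint T y‖ < ε
  rw [← map_sub]
  refine lt_of_pow_lt_pow_left₀ 2 hε.le ?_
  nlinarith [norm_nonneg ((T * adjoint T : H →L[ℂ] H) (x - y))]

end Compact

/-! ### Lifting idempotents modulo the compact operators -/

section Lifting

variable {H : Type*} [NormedAddCommGroup H] [InnerProductSpace ℂ H]

/-- Unit eigenvectors for distinct eigenvalues are orthogonal, hence at distance at least `1`. -/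
theorem countable_hasEigenvalue_of_isSymmetric [TopologicalSpace.SeparableSpace H]
    {K : H →ₗ[ℂ] H} (hK : K.IsSymmetric) : {μ : ℂ | HasEigenvalue K μ}.Countable := by
  have hex (μ : {μ : ℂ | HasEigenvalue K μ}) :
      ∃ v ∈ eigenspace K (μ : ℂ), ‖v‖ = 1 := by
    obtain ⟨v, hv⟩ := μ.2.exists_hasEigenvector
    refine ⟨((‖v‖⁻¹ : ℝ) : ℂ) • v, Submodule.smul_mem _ _ hv.1, ?_⟩
    rw [norm_smul, Complex.norm_real, norm_inv, norm_norm]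
    exact inv_mul_cancel₀ (norm_ne_zero_iff.2 hv.2)
  choose v hv hv1 using hex
  refine Set.countable_coe_iff.1 (Pairwise.countable_of_isOpen_disjoint
    (s := fun μ => Metric.ball (v μ) (1 / 2)) ?_ (fun _ => Metric.isOpen_ball)
    fun μ => ⟨v μ, Metric.mem_ball_self (by norm_num)⟩)
  intro μ ν hμν
  refine Metric.ball_disjoint_ball ?_
  have horth : inner ℂ (v μ) (v ν) = 0 :=
    hK.orthogonalFamily_eigenspaces (Subtype.coe_injective.ne hμν) ⟨v μ, hv μ⟩ ⟨v ν, hv ν⟩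
  have h := norm_sub_sq (𝕜 := ℂ) (v μ) (v ν)
  rw [horth, hv1, hv1, map_zero] at h
  rw [dist_eq_norm]
  nlinarith [norm_nonneg (v μ - v ν)]

variable [CompleteSpace H]

/-- A point `c ∈ (0, 1/2)` of the spectrum of `M` gives the nonzero eigenvalue `c ^ 2 - c` of the
compact operator `M ^ 2 - M`, and `c` is determined by it. -/
theorem exists_notMem_spectrum_of_isSelfAdjoint [TopologicalSpace.SeparableSpace H]
    {M : H →L[ℂ] H} (hM : IsSelfAdjoint M) (hcpt : IsCompactOperator (M * M - M : H →L[ℂ] H)) :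
    ∃ c : ℝ, 0 < c ∧ c < 1 ∧ c ∉ spectrum ℝ M := by
  have hK : IsSelfAdjoint (M * M - M) := by
    simpa only [← pow_two] using (hM.pow 2).sub hM
  have hcount := countable_hasEigenvalue_of_isSymmetric hK.isSymmetric
  by_contra! hall
  refine absurd ?_ (Cardinal.Real.Ioo_countable_iff (x := (0 : ℝ)) (y := 1 / 2)|>.not.2
    (by norm_num))
  refine Set.MapsTo.countable_of_injOn (f := fun c : ℝ => ((c ^ 2 - c : ℝ) : ℂ)) ?_ ?_ hcount
  · rintro c ⟨hc0, hc1⟩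
    have hne : ((c ^ 2 - c : ℝ) : ℂ) ≠ 0 := Complex.ofReal_ne_zero.2 (by nlinarith)
    refine (hcpt.hasEigenvalue_iff_mem_spectrum hne).2 fun hunit => ?_
    have hfac : algebraMap ℂ (H →L[ℂ] H) ((c ^ 2 - c : ℝ) : ℂ) - (M * M - M)
        = (algebraMap ℝ (H →L[ℂ] H) c - M) * (algebraMap ℝ (H →L[ℂ] H) c + M - 1) := by
      have hcM := Algebra.commutes c M
      have : algebraMap ℂ (H →L[ℂ] H) ((c ^ 2 - c : ℝ) : ℂ)
          = algebraMap ℝ (H →L[ℂ] H) c * algebraMap ℝ (H →L[ℂ] H) c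
            - algebraMap ℝ (H →L[ℂ] H) c := by
        rw [← map_mul, ← map_sub, ← pow_two]; rfl
      rw [this, mul_sub, mul_add, sub_mul, sub_mul, hcM]
      noncomm_ring
    have hcom : Commute (algebraMap ℝ (H →L[ℂ] H) c - M)
        (algebraMap ℝ (H →L[ℂ] H) c + M - 1) := by
      have hcM : Commute (algebraMap ℝ (H →L[ℂ] H) c) M := Algebra.commutes c M
      exact (((Commute.refl _).sub_left hcM.symm).add_right
        (hcM.sub_left (Commute.refl _))).sub_right (Commute.one_right _)
    rw [spectrum.mem_resolventSet_iff, hfac, hcom.isUnit_mul_iff] at hunit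
    exact hall c hc0 (by linarith) hunit.1
  · rintro a ⟨_, ha⟩ b ⟨_, hb⟩ hab
    have hab' : a ^ 2 - a = b ^ 2 - b := Complex.ofReal_injective hab
    have : (a - b) * (a + b - 1) = 0 := by linear_combination hab'
    rcases mul_eq_zero.1 this with h | h <;> linarith

/-- The operator `P` is the spectral projection of `M` for `(c, ∞)`, with `c` in a spectral gap. -/
theorem exists_isIdempotentElem_of_isSelfAdjoint [TopologicalSpace.SeparableSpace H]
    {M : H →L[ℂ] H} (hM : IsSelfAdjoint M) (hcpt : IsCompactOperator (M * M - M : H →L[ℂ] H)) :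
    ∃ P : H →L[ℂ] H, IsIdempotentElem P ∧ IsCompactOperator (P - M : H →L[ℂ] H) := by
  obtain ⟨c, hc0, hc1, hc⟩ := exists_notMem_spectrum_of_isSelfAdjoint hM hcpt
  have hne {x : ℝ} (hx : x ∈ spectrum ℝ M) : x ≠ c := fun h => hc (h ▸ hx)
  -- A function continuous on either side of `c` is continuous on the spectrum.
  have hcont {f g : ℝ → ℝ} (hf : ContinuousOn f (Set.Iio c)) (hg : ContinuousOn g (Set.Ioi c)) :
      ContinuousOn (fun x => if x < c then f x else g x) (spectrum ℝ M) := by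
    intro x hx
    rcases lt_or_gt_of_ne (hne hx) with h | h
    · refine ((hf.continuousAt (Iio_mem_nhds h)).congr ?_).continuousWithinAt
      filter_upwards [Iio_mem_nhds h] with y hy
      exact (if_pos hy).symm
    · refine ((hg.continuousAt (Ioi_mem_nhds h)).congr ?_).continuousWithinAt
      filter_upwards [Ioi_mem_nhds h] with y hy
      exact (if_neg (not_lt.2 (le_of_lt hy))).symm
  let f : ℝ → ℝ := fun x => if x < c then 0 else 1
  -- The quotient of `f x - x` by `x * x - x`.
  let g : ℝ → ℝ := fun x => if x < c then (1 - x)⁻¹ else -x⁻¹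
  have hf : ContinuousOn f (spectrum ℝ M) := hcont continuousOn_const continuousOn_const
  have hg : ContinuousOn g (spectrum ℝ M) := by
    refine hcont (ContinuousOn.inv₀ (by fun_prop) fun x hx => ?_)
      (ContinuousOn.neg (ContinuousOn.inv₀ continuousOn_id fun x hx => ?_))
    · have : x < c := hx
      linarith
    · exact (hc0.trans hx).ne'
  refine ⟨cfc f M, ?_, ?_⟩
  · rw [IsIdempotentElem, ← cfc_mul f f M hf hf]
    refine cfc_congr fun x _ => ?_
    by_cases h : x < c <;> simp [f, h]
  · have hquad : cfc (fun x : ℝ => x * x - x) M = M * M - M := by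
      rw [cfc_sub (fun x : ℝ => x * x) (fun x : ℝ => x) M, cfc_mul (fun x : ℝ => x) (fun x => x) M,
        cfc_id' ℝ M]
    have hfac : cfc f M - M = cfc g M * (M * M - M) := by
      rw [← hquad, ← cfc_mul g (fun x : ℝ => x * x - x) M hg (by fun_prop)]
      nth_rewrite 2 [← cfc_id' ℝ M]
      rw [← cfc_sub f (fun x : ℝ => x) M hf (by fun_prop)]
      refine cfc_congr fun x hx => ?_
      by_cases h : x < c
      · have : 1 - x ≠ 0 := by linarith
        simp only [f, g, h, if_true]
        field_simp
        ring
      · have : x ≠ 0 := by linarith [not_lt.1 h]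
        simp only [f, g, h, if_false]
        field_simp
        ring
    rw [hfac]
    exact hcpt.clm_comp (cfc g M)

/-- Idempotents lift from the Calkin algebra. -/
theorem exists_isIdempotentElem_isCompactOperator_sub [TopologicalSpace.SeparableSpace H]
    {A : H →L[ℂ] H} (hA : IsCompactOperator (A * A - A : H →L[ℂ] H)) :
    ∃ S : H →L[ℂ] H, IsIdempotentElem S ∧ IsCompactOperator (A - S : H →L[ℂ] H) := by
  let q := Ideal.Quotient.mk (compactIdeal H)
  have hq {S T : H →L[ℂ] H} : q S = q T ↔ IsCompactOperator (S - T : H →L[ℂ] H) :=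
    mk_eq_mk_iff_isCompactOperator_sub
  have hs : q A * q A = q A := by rw [← map_mul]; exact hq.2 hA
  have ht : q (star A) * q (star A) = q (star A) := by
    rw [← map_mul, hq, ← star_mul, ← star_sub]
    exact isCompactOperator_adjoint hA
  -- `D = 1 + B† B` with `B = A† - A`.
  let D : H →L[ℂ] H := 1 + (A - star A) * (star A - A)
  have hstar : star (star A - A) = A - star A := by rw [star_sub, star_star]
  have hDunit : IsUnit D := by
    have h0 : 0 ≤ (A - star A) * (star A - A) := by
      rw [← hstar]; exact star_mul_self_nonneg _
    exact (IsStrictlyPositive.add_nonneg isStrictlyPositive_one h0).isUnit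
  have hDsa : star D = D := by
    simp only [D, star_add, star_one, star_mul, star_sub, star_star]
  obtain ⟨E, hDE, hED⟩ := isUnit_iff_exists.1 hDunit
  have hEsa : star E = E := by
    have h : star E * D = 1 := by rw [← hDsa, ← star_mul, hDE, star_one]
    exact left_inv_eq_right_inv h hDE
  have hqD : q D = 1 + (q A - q (star A)) * (q (star A) - q A) := by
    simp only [D, map_add, map_mul, map_sub, map_one]
  obtain ⟨hcomm, hps, hpp⟩ := range_idempotent_relations hs ht
    (e := q E) (by rw [← hqD, ← map_mul, hED, map_one]) (by rw [← hqD, ← map_mul, hDE, map_one])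
  let Q := A * star A * E
  -- `Q` lifts `p` but need not be self-adjoint; `Q† Q` is a self-adjoint lift of `p * p = p`.
  have hM : q (star Q * Q) = q A * q (star A) * q E := by
    rw [map_mul]
    simp only [Q, star_mul, star_star, hEsa, map_mul]
    rw [hcomm, hpp]
  obtain ⟨P, hP, hPM⟩ := exists_isIdempotentElem_of_isSelfAdjoint
    (IsSelfAdjoint.star_mul_self Q) (hq.1 (by rw [map_mul, hM, hpp]))
  have hqP : q P = q A * q (star A) * q E := (hq.2 hPM).trans hM
  have hPA : q P * q A = q A := by rw [hqP, hps]
  have hAP : q A * q P = q P := by rw [hqP, ← mul_assoc, ← mul_assoc, hs]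
  refine ⟨P + P * A * (1 - P), isIdempotentElem_add_mul_one_sub hP A, hq.1 ?_⟩
  rw [map_add, map_mul, map_mul, map_sub, map_one, hPA, mul_sub, hAP, mul_one]
  abel

end Lifting

theorem corollary5p3 {H : Type*} [NormedAddCommGroup H] [InnerProductSpace ℂ H]
    [CompleteSpace H] [TopologicalSpace.SeparableSpace H]
    (T₁ T₂ : H →L[ℂ] H) (hT₁ : IsIdempotentElem T₁) (hT₂ : IsIdempotentElem T₂)
    (hcomm : IsCompactOperator (T₁ * T₂ - T₂ * T₁ : H →L[ℂ] H)) :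
    IsCompactOperator (T₁ + T₂ - 1 : H →L[ℂ] H) ∨
    IsCompactOperator (T₁ - T₂ : H →L[ℂ] H) ∨
    ∃ S : H →L[ℂ] H, IsIdempotentElem S ∧
      ¬ FiniteDimensional ℂ (LinearMap.range (S : H →ₗ[ℂ] H)) ∧
      ¬ FiniteDimensional ℂ
        (LinearMap.ker (ContinuousLinearMap.adjoint S : H →ₗ[ℂ] H)) ∧
      IsCompactOperator ((T₁ - T₂) ^ 2 - S : H →L[ℂ] H) ∧
      IsCompactOperator ((T₁ + T₂ - 1) * S : H →L[ℂ] H) := by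
  let q := Ideal.Quotient.mk (compactIdeal H)
  have hq {S T : H →L[ℂ] H} : q S = q T ↔ IsCompactOperator (S - T : H →L[ℂ] H) :=
    mk_eq_mk_iff_isCompactOperator_sub
  have hq0 {S : H →L[ℂ] H} : q S = 0 ↔ IsCompactOperator S := Ideal.Quotient.eq_zero_iff_mem
  obtain ⟨hidem, hsum, hdiff⟩ := sub_sq_relations (a := q T₁) (b := q T₂)
    (by rw [← map_mul, hT₁.eq]) (by rw [← map_mul, hT₂.eq])
    (by rw [← map_mul, ← map_mul]; exact hq.2 hcomm)
  have hqA : q ((T₁ - T₂) ^ 2) = (q T₁ - q T₂) ^ 2 := by rw [map_pow, map_sub]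
  obtain ⟨S, hS, hAS⟩ := exists_isIdempotentElem_isCompactOperator_sub
    (A := (T₁ - T₂) ^ 2) (hq.1 (by rw [map_mul, hqA, hidem]))
  have hqS : q S = (q T₁ - q T₂) ^ 2 := (hq.2 hAS).symm.trans hqA
  have hqsum : q (T₁ + T₂ - 1) = q T₁ + q T₂ - 1 := by rw [map_sub, map_add, map_one]
  by_cases hran : FiniteDimensional ℂ (LinearMap.range (S : H →ₗ[ℂ] H))
  · refine Or.inr (Or.inl (hq0.1 ?_))
    have h0 : q S = 0 := hq0.2 (isCompactOperator_of_finiteDimensional_range hran)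
    rw [map_sub, ← hdiff, ← hqS, h0, mul_zero]
  by_cases hker : FiniteDimensional ℂ
      (LinearMap.ker (ContinuousLinearMap.adjoint S : H →ₗ[ℂ] H))
  · refine Or.inl (hq0.1 ?_)
    have hSs : star S * star S = star S := by rw [← star_mul, hS.eq]
    have hle : LinearMap.range ((1 - star S : H →L[ℂ] H) : H →ₗ[ℂ] H) ≤
        LinearMap.ker (ContinuousLinearMap.adjoint S : H →ₗ[ℂ] H) := by
      rintro _ ⟨x, rfl⟩
      have h : star S * (1 - star S) = 0 := by rw [mul_sub, mul_one, hSs, sub_self]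
      exact DFunLike.congr_fun h x
    have hfin := Submodule.finiteDimensional_of_le hle
    have hcpt := isCompactOperator_adjoint (isCompactOperator_of_finiteDimensional_range hfin)
    rw [← ContinuousLinearMap.star_eq_adjoint, star_sub, star_one, star_star] at hcpt
    have h1 : q S = 1 := (hq.2 hcpt).symm.trans (map_one q)
    rw [← hqS, h1, mul_one] at hsum
    rw [hqsum, hsum]
  · exact Or.inr (Or.inr ⟨S, hS, hran, hker, hAS,
      hq0.1 (by rw [map_mul, hqsum, hqS, hsum])⟩)
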